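/- **Theorem 1.** Let $\mathcal X$ be a finite set, let $\mathcal H_E$ be a finite-dimensional complex Hilbert space, and let $\rho_{XE}=\sum_{x\in\mathcal X}p_X(x)\,|x\rangle\langle x|\otimes\rho_E^x$ be a classical-quantum state, i.e. $p_X$ is a probability mass function on $\mathcal X$ and every $\rho_E^x$ is a density operator on $\mathcal H_E$. Put $\rho_E=\sum_x p_X(x)\rho_E^x$, and let $\nu=|\mathrm{spec}(\rho_E)|$ be the number of distinct eigenvalues of $\rho_E$. For $0<\eta<1$ let $$H_{\mathrm h}^{\eta}(X|E)_\rho=-\sup\bigl\{-\log\operatorname{Tr}[(\mathbb 1_X\otimes\rho_E)T]\;:\;0\le T\le\mathbb 1,\ \operatorname{Tr}[\rho_{XE}T]\ge 1-\eta\bigr\}$$ (natural logarithm). A random function $h:\mathcal X\to\mathcal Z$ into a finite non-empty set $\mathcal Z$ is *strongly 2-universal* if $\Pr_h\{h(x)=z\wedge h(x')=z'\}=|\mathcal Z|^{-2}$ for all $x\ne x'$ in $\mathcal X$ and all $z,z'\in\mathcal Z$. It is *$\varepsilon$-secret* if $$\tfrac12\,\mathbb E_h\Bigl\|\sum_{x}p_X(x)|h(x)\rangle\langle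 h(x)|\otimes\rho_E^x-\tfrac{\mathbb 1_Z}{|\mathcal Z|}\otimes\rho_E\Bigr\|_1\le\varepsilon,\qquad \|A\|_1=\operatorname{Tr}\sqrt{A^\dagger A}.$$ Let $\ell^{\varepsilon}(X|E)_\rho$ be the supremum of all $\ell\in\mathbb N$ for which there is an $\varepsilon$-secret strongly 2-universal random function $h:\mathcal X\to\mathcal Z$ with $|\mathcal Z|\ge\ell$. Then, for all $0<\varepsilon<1$ and $0<c<\delta<\min\{\tfrac{\varepsilon}{3},\tfrac{1-\varepsilon}{2}\}$, $$H_{\mathrm h}^{1-\varepsilon+3\delta}(X|E)_\rho-\log\frac{\nu^2}{\delta^4}\;\le\;\log\ell^{\varepsilon}(X|E)_\rho\;\le\;H_{\mathrm h}^{1-\varepsilon-2\delta}(X|E)_\rho+\log\frac{1+c}{c\,\delta}+\log\frac{\varepsilon+c}{\delta-c}.$$ Moreover, both bounds hold for every prescribed choice of the hash functions: if for every $m\ge1$ a strongly 2-universal random function $h_m$ from $\mathcal X$ to a set of size $m$ is given, then the same two inequalities hold with $\ell^\varepsilon(X|E)_\rho$ replaced by the supremum of all $\ell\in\mathbb N$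 such that $h_m$ is $\varepsilon$-secret for some $m\ge\ell$. -/

import Mathlib

open scoped Kronecker ComplexOrder MatrixOrder ENNReal

namespace PrivacyAmplification

/-- The Schatten 1-norm `‖A‖₁ = Tr √(A† A)` of a complex square matrix. -/
noncomputable def traceNorm {n : Type*} [Fintype n] [DecidableEq n] (A : Matrix n n ℂ) : ℝ :=
  (CFC.sqrt (A.conjTranspose * A)).trace.re

/-- A classical-quantum state `ρ_XE = ∑ x, p x • |x⟩⟨x| ⊗ ρ_E^x`: a probability mass function `p`
on `X` and, for every `x`, a density operator `state x` on the system `E`. -/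
structure CQState (X E : Type*) [Fintype X] [Fintype E] where
  /-- The probability mass function of the classical system. -/
  p : X → ℝ
  p_nonneg : ∀ x, 0 ≤ p x
  p_sum : ∑ x, p x = 1
  /-- The density operator on `E` associated with each classical value. -/
  state : X → Matrix E E ℂ
  state_posSemidef : ∀ x, (state x).PosSemidef
  state_trace : ∀ x, (state x).trace = 1

section

variable {X E : Type*} [Fintype X] [DecidableEq X] [Fintype E] [DecidableEq E]

/-- The joint density operator `ρ_XE`. -/
noncomputable def CQState.joint (ρ : CQState X E) : Matrix (X × E) (X × E) ℂ :=
  ∑ x, (ρ.p x : ℂ) • (Matrix.single x x (1 : ℂ) ⊗ₖ ρ.state x)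

/-- The marginal density operator `ρ_E = Tr_X ρ_XE = ∑ x, p x • ρ_E^x`. -/
noncomputable def CQState.marginal {X E : Type*} [Fintype X] [Fintype E] (ρ : CQState X E) :
    Matrix E E ℂ :=
  ∑ x, (ρ.p x : ℂ) • ρ.state x

/-- The number of distinct eigenvalues of `ρ_E`. -/
noncomputable def CQState.numEigenvalues (ρ : CQState X E) : ℕ :=
  (spectrum ℂ ρ.marginal).ncard

/-- The `ε`-hypothesis testing divergence
`D_h^ε(ρ ‖ σ) = sup {- log Tr[σ T] : 0 ≤ T ≤ 1, Tr[ρ T] ≥ 1 - ε}`, natural logarithm, with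
values in the extended reals. -/
noncomputable def hypTestDivergence {n : Type*} [Fintype n] [DecidableEq n]
    (ε : ℝ) (ρ σ : Matrix n n ℂ) : EReal :=
  sSup {r : EReal | ∃ T : Matrix n n ℂ, T.PosSemidef ∧ (1 - T).PosSemidef ∧
    1 - ε ≤ (ρ * T).trace.re ∧ r = -ENNReal.log (ENNReal.ofReal (σ * T).trace.re)}

/-- The conditional `ε`-hypothesis testing entropy
`H_h^ε(X|E)_ρ = - D_h^ε(ρ_XE ‖ 1_X ⊗ ρ_E)`. -/
noncomputable def CQState.condHypTestEntropy (ρ : CQState X E) (ε : ℝ) : EReal :=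
  -hypTestDivergence ε ρ.joint ((1 : Matrix X X ℂ) ⊗ₖ ρ.marginal)

section

variable {Z : Type*} [Fintype Z] [DecidableEq Z]

/-- A random function `h : X → Z`, given by its law on `X → Z`, is strongly 2-universal if
`Pr {h x = z ∧ h x' = z'} = 1 / |Z|²` for all `x ≠ x'` and all `z, z'`. -/
def IsStronglyTwoUniversal {X Z : Type*} [Fintype Z] (h : PMF (X → Z)) : Prop :=
  ∀ x x' : X, x ≠ x' → ∀ z z' : Z,
    h.toOuterMeasure {f | f x = z ∧ f x' = z'} = 1 / (Fintype.card Z : ℝ≥0∞) ^ 2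

/-- The hashed state `R^f(ρ_XE) = ∑ x, p x • |f x⟩⟨f x| ⊗ ρ_E^x`. -/
noncomputable def CQState.hashed (ρ : CQState X E) (f : X → Z) : Matrix (Z × E) (Z × E) ℂ :=
  ∑ x, (ρ.p x : ℂ) • (Matrix.single (f x) (f x) (1 : ℂ) ⊗ₖ ρ.state x)

/-- The ideal state `U(ρ_XE) = (1_Z / |Z|) ⊗ ρ_E`. -/
noncomputable def CQState.ideal (Z : Type*) [Fintype Z] [DecidableEq Z] (ρ : CQState X E) :
    Matrix (Z × E) (Z × E) ℂ :=
  ((Fintype.card Z : ℂ)⁻¹ • (1 : Matrix Z Z ℂ)) ⊗ₖ ρ.marginal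

/-- The security parameter `½ E_h ‖R^h(ρ_XE) - U(ρ_XE)‖₁` of a random hash function with law
`h`. -/
noncomputable def CQState.insecurity (ρ : CQState X E) (h : PMF (X → Z)) : ℝ :=
  1 / 2 * ∑ f : X → Z, (h f).toReal * traceNorm (ρ.hashed f - ρ.ideal Z)

end

/-- The maximal extractable randomness `ℓ^ε(X|E)_ρ`: the supremum of all `ℓ ∈ ℕ` such that some
strongly 2-universal random hash function whose range has at least `ℓ` elements is `ε`-secret. -/
noncomputable def CQState.maxExtractable (ρ : CQState X E) (ε : ℝ) : ℕ∞ :=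
  sSup {r : ℕ∞ | ∃ ℓ : ℕ, r = ℓ ∧ ∃ (m : ℕ+) (h : PMF (X → Fin m)),
    IsStronglyTwoUniversal h ∧ ℓ ≤ (m : ℕ) ∧ ρ.insecurity h ≤ ε}

/-- The maximal randomness that can be extracted with prescribed random hash functions
`h m : X → {0, …, m - 1}`, one for every size `m ≥ 1` of the range. -/
noncomputable def CQState.maxExtractableWith (ρ : CQState X E)
    (h : ∀ m : ℕ+, PMF (X → Fin m)) (ε : ℝ) : ℕ∞ :=
  sSup {r : ℕ∞ | ∃ ℓ : ℕ, r = ℓ ∧ ∃ m : ℕ+, ℓ ≤ (m : ℕ) ∧ ρ.insecurity (h m) ≤ ε}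

end

end PrivacyAmplification

namespace PrivacyAmplification

section Matrices

variable {n : Type*} [Fintype n] [DecidableEq n]

theorem continuousOn_spectrum (f : ℝ → ℝ) (A : Matrix n n ℂ) : ContinuousOn f (spectrum ℝ A) :=
  A.finite_real_spectrum.continuousOn f

omit [DecidableEq n] in
theorem re_trace_nonneg {A : Matrix n n ℂ} (hA : 0 ≤ A) : 0 ≤ A.trace.re :=
  (Complex.nonneg_iff.1 (Matrix.nonneg_iff_posSemidef.1 hA).trace_nonneg).1

omit [DecidableEq n] in
theorem re_trace_mono {A B : Matrix n n ℂ} (h : A ≤ B) : A.trace.re ≤ B.trace.re := by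
  have := re_trace_nonneg (sub_nonneg.2 h)
  simpa [Matrix.trace_sub] using this

/-- The trace of a product of two positive matrices is nonnegative. -/
theorem re_trace_mul_nonneg {A B : Matrix n n ℂ} (hA : 0 ≤ A) (hB : 0 ≤ B) :
    0 ≤ (A * B).trace.re := by
  obtain ⟨C, rfl⟩ := CStarAlgebra.nonneg_iff_eq_star_mul_self.1 hA
  rw [mul_assoc, Matrix.trace_mul_comm]
  exact re_trace_nonneg (star_right_conjugate_nonneg hB C)

theorem re_trace_mul_mono {A B C : Matrix n n ℂ} (hA : 0 ≤ A) (h : B ≤ C) :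
    (A * B).trace.re ≤ (A * C).trace.re := by
  have := re_trace_mul_nonneg hA (sub_nonneg.2 h)
  simpa [mul_sub, Matrix.trace_sub] using this

theorem abs_sign_le_one (x : ℝ) : |Real.sign x| ≤ 1 := by
  rcases Real.sign_apply_eq x with h | h | h <;> simp [h]

/-- For hermitian `A`, the trace norm is attained by testing with the sign of `A`. -/
theorem exists_traceNorm_eq {A : Matrix n n ℂ} (hA : IsSelfAdjoint A) :
    ∃ K : Matrix n n ℂ, IsSelfAdjoint K ∧ -1 ≤ K ∧ K ≤ 1 ∧ traceNorm A = (A * K).trace.re := by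
  refine ⟨cfc Real.sign A, cfc_predicate _ _, ?_, ?_, ?_⟩
  · have h := cfc_mono (f := fun _ => (-1 : ℝ)) (g := Real.sign) (a := A)
      (fun x _ => (abs_le.1 (abs_sign_le_one x)).1)
      (continuousOn_spectrum _ A) (continuousOn_spectrum _ A)
    rwa [cfc_const (-1 : ℝ) A, map_neg, map_one] at h
  · exact cfc_le_one _ _ fun x _ => (abs_le.1 (abs_sign_le_one x)).2
  · have e : CFC.sqrt (A.conjTranspose * A) = A * cfc Real.sign A := by
      conv_rhs => enter [1]; rw [← cfc_id' ℝ A]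
      rw [← cfc_mul _ _ A (continuousOn_spectrum _ A) (continuousOn_spectrum _ A)]
      change CFC.abs A = _
      rw [CFC.abs_eq_cfcₙ_norm A hA, cfcₙ_eq_cfc]
      refine cfc_congr fun x _ => ?_
      rcases lt_trichotomy x 0 with h | h | h
      · simp [Real.sign_of_neg h, abs_of_neg h]
      · simp [h]
      · simp [Real.sign_of_pos h, abs_of_pos h]
    rw [traceNorm, e]

theorem re_trace_mul_le_traceNorm {A K : Matrix n n ℂ} (hA : IsSelfAdjoint A)
    (h₁ : -1 ≤ K) (h₂ : K ≤ 1) : (A * K).trace.re ≤ traceNorm A := by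
  have e : traceNorm A = (CFC.abs A).trace.re := rfl
  have p₁ : 0 ≤ CFC.abs A + A := by
    rw [CFC.abs_add_self A hA, two_nsmul]
    exact add_nonneg (CFC.posPart_nonneg A) (CFC.posPart_nonneg A)
  have p₂ : 0 ≤ CFC.abs A - A := by
    rw [CFC.abs_sub_self A hA, two_nsmul]
    exact add_nonneg (CFC.negPart_nonneg A) (CFC.negPart_nonneg A)
  have q₁ := re_trace_mul_nonneg p₁ (sub_nonneg.2 h₂)
  have q₂ := re_trace_mul_nonneg p₂ (neg_le_iff_add_nonneg'.1 h₁)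
  simp [mul_sub, mul_add, add_mul, sub_mul, Matrix.trace_add, Matrix.trace_sub] at q₁ q₂
  rw [e]; linarith

theorem mul_self_le_one {K : Matrix n n ℂ} (h₁ : -1 ≤ K) (h₂ : K ≤ 1) : K * K ≤ 1 := by
  have a₁ : 0 ≤ 1 - K := sub_nonneg.2 h₂
  have a₂ : 0 ≤ 1 + K := by simpa [add_comm] using sub_nonneg.2 h₁
  have b₁ := (IsSelfAdjoint.of_nonneg a₁).conjugate_nonneg a₂
  have b₂ := (IsSelfAdjoint.of_nonneg a₂).conjugate_nonneg a₁
  have := smul_nonneg (show (0:ℝ) ≤ 1/2 by norm_num) (add_nonneg b₁ b₂)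
  rw [← sub_nonneg]
  convert this using 1
  have : (1 - K) * (1 + K) * (1 - K) + (1 + K) * (1 - K) * (1 + K) = (2:ℝ) • (1 - K * K) := by
    rw [two_smul]; noncomm_ring
  rw [this, smul_smul]; norm_num

/-- Cauchy-Schwarz inequality with weight, in additive form. -/
theorem two_mul_re_trace_mul_le {Y K τ : Matrix n n ℂ} (hτ : τ.PosDef) (hK : IsSelfAdjoint K)
    {l : ℝ} (hl : 0 < l) :
    2 * (Y * K).trace.re ≤
      l * (Y * τ⁻¹ * star Y).trace.re + l⁻¹ * (K * τ * K).trace.re := by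
  have hd : IsUnit τ.det := (Matrix.isUnit_iff_isUnit_det _).1 hτ.isUnit
  have hs : star τ = τ := hτ.isHermitian
  have h := re_trace_nonneg (star_right_conjugate_nonneg
    (Matrix.nonneg_iff_posSemidef.2 hτ.inv.posSemidef) (l • Y - K * τ))
  have e : (l • Y - K * τ) * τ⁻¹ * star (l • Y - K * τ) =
      (l * l) • (Y * τ⁻¹ * star Y) - l • (Y * K) - l • (K * star Y) + K * τ * K := by
    have h₁ : τ⁻¹ * τ = 1 := Matrix.nonsing_inv_mul _ hd
    have h₂ : τ * τ⁻¹ = 1 := Matrix.mul_nonsing_inv _ hd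
    simp only [star_sub, star_smul, star_mul, hs, hK.star_eq, sub_mul, mul_sub, smul_mul_assoc,
      mul_smul_comm, star_trivial]
    rw [← mul_assoc _ τ K, mul_assoc Y τ⁻¹ τ, ← mul_assoc _ τ K, mul_assoc K τ τ⁻¹, h₂, h₁,
      mul_one, mul_one, smul_sub, smul_smul]
    abel
  have c : (K * star Y).trace.re = (Y * K).trace.re := by
    have : K * star Y = star (Y * K) := by rw [star_mul, hK.star_eq]
    rw [this, Matrix.star_eq_conjTranspose, Matrix.trace_conjTranspose]; simp
  rw [e] at h
  simp [Matrix.trace_add, Matrix.trace_sub, Matrix.trace_smul, c] at h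
  have := mul_nonneg (inv_nonneg.2 hl.le) h
  field_simp at this ⊢
  linarith

/-- If `N* N ≤ k τ`, then `N τ⁻¹ N* ≤ k`. -/
theorem mul_inv_mul_star_le {N τ : Matrix n n ℂ} (hτ : τ.PosDef) {k : ℝ} (hk : 0 < k)
    (h : star N * N ≤ k • τ) : N * τ⁻¹ * star N ≤ k • 1 := by
  have := hτ.isUnit.invertible
  have hk1 : ((k : ℝ) • (1 : Matrix n n ℂ)).PosDef := Matrix.PosDef.one.smul hk
  have := hk1.isUnit.invertible
  have e : (k • (1 : Matrix n n ℂ))⁻¹ = k⁻¹ • 1 :=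
    Matrix.inv_eq_left_inv (by rw [smul_mul_smul_comm, inv_mul_cancel₀ hk.ne', one_smul, one_mul])
  have h1 := Matrix.PosDef.fromBlocks₁₁ N.conjTranspose (k • (1 : Matrix n n ℂ)) hτ
  have h2 := Matrix.PosDef.fromBlocks₂₂ τ N.conjTranspose hk1
  rw [Matrix.conjTranspose_conjTranspose] at h1 h2
  refine Matrix.le_iff.2 (h1.1 (h2.2 ?_))
  rw [e, mul_smul_comm, smul_mul_assoc, mul_one]
  have := smul_le_smul_of_nonneg_left h (inv_nonneg.2 hk.le)
  rw [smul_smul, inv_mul_cancel₀ hk.ne', one_smul] at this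
  exact Matrix.le_iff.1 this

/-- A version of `mul_inv_mul_star_le` for a positive matrix sandwiched by a hermitian one. -/
theorem mul_inv_mul_le_smul {A Q τ : Matrix n n ℂ} (hA : 0 ≤ A) (hQ : IsSelfAdjoint Q)
    (hτ : τ.PosDef) {k : ℝ} (hk : 0 < k) (h : Q * A * Q ≤ k • τ) :
    A * Q * τ⁻¹ * Q * A ≤ k • A := by
  obtain ⟨L, rfl⟩ := CStarAlgebra.nonneg_iff_eq_star_mul_self.1 hA
  have h1 := mul_inv_mul_star_le (N := L * Q) hτ hk
    (by simpa only [star_mul, hQ.star_eq, mul_assoc] using h)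
  have h2 := star_left_conjugate_le_conjugate h1 L
  simpa only [star_mul, hQ.star_eq, mul_assoc, mul_smul_comm, smul_mul_assoc, one_mul] using h2

section

open scoped Matrix.Norms.L2Operator

theorem inv_le_inv_of_le {A B : Matrix n n ℂ} (hA : A.PosDef) (h : A ≤ B) : B⁻¹ ≤ A⁻¹ := by
  rw [Matrix.nonsing_inv_eq_ringInverse, Matrix.nonsing_inv_eq_ringInverse]
  exact CStarAlgebra.ringInverse_le_ringInverse h (Matrix.isStrictlyPositive_iff_posDef.2 hA)

end

/-- `S (S + c)⁻¹ ≥ T / (1 + c)` for `0 ≤ T ≤ S` and `T ≤ 1`, and `S (S + c)⁻¹ ≤ S / c`. -/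
theorem exists_test_of_nonneg {S : Matrix n n ℂ} (hS : 0 ≤ S) {c : ℝ} (hc : 0 < c) :
    ∃ M : Matrix n n ℂ, 0 ≤ M ∧ M ≤ 1 ∧ M ≤ c⁻¹ • S ∧
      ∀ T : Matrix n n ℂ, 0 ≤ T → T ≤ 1 → T ≤ S → (1 + c)⁻¹ • T ≤ M := by
  have posDef : ∀ T : Matrix n n ℂ, 0 ≤ T → (T + c • 1).PosDef := fun T hT =>
    (Matrix.PosDef.one.smul hc).posSemidef_add (Matrix.nonneg_iff_posSemidef.1 hT)
  have inv_eq : ∀ T : Matrix n n ℂ, 0 ≤ T →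
      1 - c • (T + c • 1)⁻¹ = cfc (fun t : ℝ => 1 - c * (t + c)⁻¹) T := fun T hT => by
    have hT' : IsSelfAdjoint T := IsSelfAdjoint.of_nonneg hT
    have e : (T + c • 1)⁻¹ = cfc (fun t : ℝ => (t + c)⁻¹) T := by
      refine Matrix.inv_eq_left_inv ?_
      have e₁ : T + c • 1 = cfc (fun t : ℝ => t + c) T := by
        rw [cfc_add_const c _ T, cfc_id' ℝ T, Algebra.algebraMap_eq_smul_one]
      rw [e₁, ← cfc_mul _ _ T (continuousOn_spectrum _ T) (continuousOn_spectrum _ T),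
        ← cfc_one ℝ T]
      refine cfc_congr fun x hx => ?_
      have := spectrum_nonneg_of_nonneg hT hx
      exact inv_mul_cancel₀ (by positivity)
    rw [e, ← cfc_const_mul _ _ T (continuousOn_spectrum _ T), ← cfc_one ℝ T,
      ← cfc_sub _ _ T (continuousOn_spectrum _ T) (continuousOn_spectrum _ T)]
    rfl
  have hS' : IsSelfAdjoint S := IsSelfAdjoint.of_nonneg hS
  refine ⟨1 - c • (S + c • 1)⁻¹, ?_, ?_, ?_, fun T hT hT₁ hTS => ?_⟩
  · rw [inv_eq S hS]
    refine cfc_nonneg fun x hx => ?_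
    have := spectrum_nonneg_of_nonneg hS hx
    rw [sub_nonneg, ← div_eq_mul_inv, div_le_one (by positivity)]
    linarith
  · exact sub_le_self _ (smul_nonneg hc.le
      (Matrix.nonneg_iff_posSemidef.2 (posDef S hS).inv.posSemidef))
  · rw [inv_eq S hS]
    conv_rhs => rw [← cfc_id' ℝ S]
    rw [← cfc_const_mul _ _ S]
    refine cfc_mono (fun x hx => ?_) (continuousOn_spectrum _ S) (continuousOn_spectrum _ S)
    have := spectrum_nonneg_of_nonneg hS hx
    field_simp
    nlinarith
  · have hT' : IsSelfAdjoint T := IsSelfAdjoint.of_nonneg hT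
    have anti : (S + c • 1)⁻¹ ≤ (T + c • 1)⁻¹ :=
      inv_le_inv_of_le (posDef T hT) (add_le_add_left hTS _)
    refine le_trans ?_ (sub_le_sub_left (smul_le_smul_of_nonneg_left anti hc.le) 1)
    rw [inv_eq T hT]
    have hx₁ : ∀ x ∈ spectrum ℝ T, x ≤ 1 := by
      rw [← cfc_id' ℝ T, cfc_le_one_iff _ T (continuousOn_spectrum _ T)] at hT₁
      exact hT₁
    conv_lhs => rw [← cfc_id' ℝ T]
    rw [← cfc_const_mul _ _ T]
    refine cfc_mono (fun x hx => ?_) (continuousOn_spectrum _ T) (continuousOn_spectrum _ T)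
    have h₀ := spectrum_nonneg_of_nonneg hT hx
    have h₁ := hx₁ x hx
    have : 1 - c * (x + c)⁻¹ = x * (x + c)⁻¹ := by
      field_simp
      ring
    rw [this, mul_comm]
    gcongr

end Matrices
section Pinching

variable {n : Type*} [Fintype n] [DecidableEq n]

/-- The spectral projections of a hermitian matrix, indexed by its distinct eigenvalues. -/
theorem exists_spectral_projections {σ : Matrix n n ℂ} (hσ : IsSelfAdjoint σ) :
    ∃ (s : Finset ℝ) (P : ℝ → Matrix n n ℂ), s.card = (spectrum ℂ σ).ncard ∧
      (∀ i, IsSelfAdjoint (P i)) ∧ (∀ i, P i * P i = P i) ∧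
      (∀ i j, i ≠ j → P i * P j = 0) ∧ ∑ i ∈ s, P i = 1 ∧
      (∀ i, σ * P i = i • P i) := by
  refine ⟨σ.finite_real_spectrum.toFinset, fun i => cfc (fun x : ℝ => if x = i then 1 else 0) σ,
    ?_, fun i => cfc_predicate _ _, fun i => ?_, fun i j hij => ?_, ?_, fun i => ?_⟩
  · have h : σ.IsHermitian := hσ
    rw [← Set.ncard_eq_toFinset_card _ σ.finite_real_spectrum, h.spectrum_eq_image_range, h.spectrum_real_eq_range_eigenvalues,
      Set.ncard_image_of_injective _ (algebraMap ℝ ℂ).injective]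
  · rw [← cfc_mul _ _ σ (continuousOn_spectrum _ σ) (continuousOn_spectrum _ σ)]
    exact cfc_congr fun x _ => by simp
  · rw [← cfc_mul _ _ σ (continuousOn_spectrum _ σ) (continuousOn_spectrum _ σ),
      ← cfc_zero ℝ σ]
    exact cfc_congr fun x _ => by
      by_cases h : x = i
      · simp [h, hij]
      · simp [h]
  · rw [← cfc_sum _ σ _ (fun i _ => continuousOn_spectrum _ σ), ← cfc_one ℝ σ]
    exact cfc_congr fun x hx => by simp [Finset.sum_apply, hx]
  · conv_lhs => enter [1]; rw [← cfc_id' ℝ σ]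
    rw [← cfc_mul _ _ σ (continuousOn_spectrum _ σ) (continuousOn_spectrum _ σ),
      ← cfc_const_mul _ _ σ (continuousOn_spectrum _ σ)]
    exact cfc_congr fun x _ => by
      by_cases h : x = i <;> simp [h]

/-- The pinching inequality. -/
theorem le_card_smul_sum_conj {s : Finset ℝ} {P : ℝ → Matrix n n ℂ}
    (hP : ∀ i, IsSelfAdjoint (P i)) (hsum : ∑ i ∈ s, P i = 1) {A : Matrix n n ℂ} (hA : 0 ≤ A) :
    A ≤ (s.card : ℝ) • ∑ i ∈ s, P i * A * P i := by
  have h : 0 ≤ ∑ i ∈ s, ∑ j ∈ s, (P i - P j) * A * (P i - P j) :=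
    Finset.sum_nonneg fun i _ => Finset.sum_nonneg fun j _ =>
      ((hP i).sub (hP j)).conjugate_nonneg hA
  have e : ∑ i ∈ s, ∑ j ∈ s, (P i - P j) * A * (P i - P j) =
      (2 : ℝ) • ((s.card : ℝ) • ∑ i ∈ s, P i * A * P i - A) := by
    have e₁ : ∑ i ∈ s, ∑ j ∈ s, P i * A * P j = A := by
      simp_rw [← Finset.mul_sum, hsum, mul_one, ← Finset.sum_mul, hsum, one_mul]
    have e₂ : ∑ i ∈ s, ∑ j ∈ s, P j * A * P i = A := by
      rw [Finset.sum_comm, e₁]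
    simp only [sub_mul, mul_sub, Finset.sum_sub_distrib, e₁, e₂, Finset.sum_const,
      ← Nat.cast_smul_eq_nsmul ℝ, ← Finset.smul_sum]
    rw [two_smul]
    abel
  rw [e] at h
  have := smul_nonneg (show (0 : ℝ) ≤ 2⁻¹ by norm_num) h
  rw [smul_smul, inv_mul_cancel₀ two_ne_zero, one_smul] at this
  exact sub_nonneg.1 this

/-- A likelihood ratio test between `A` and `σ` that commutes with `σ`. -/
theorem exists_commuting_test {A σ : Matrix n n ℂ} (hA : 0 ≤ A) (hσ : 0 ≤ σ) {γ : ℝ}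
    (hγ : 0 < γ) :
    ∃ Q : Matrix n n ℂ, IsSelfAdjoint Q ∧ Q * Q = Q ∧
      γ * (σ * Q).trace.re ≤ (A * Q).trace.re ∧
      (1 - Q) * A * (1 - Q) ≤ ((spectrum ℂ σ).ncard * γ) • σ := by
  obtain ⟨s, P, hcard, hP, hPP, hPP', hsum, hσP⟩ :=
    exists_spectral_projections (IsSelfAdjoint.of_nonneg hσ)
  set B := ∑ i ∈ s, P i * A * P i with hB
  have hPσ : ∀ i, P i * σ = i • P i := fun i => by
    have := congrArg star (hσP i)
    rwa [star_mul, star_smul, (hP i).star_eq, (IsSelfAdjoint.of_nonneg hσ).star_eq,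
      star_trivial] at this
  have hBσ : Commute B σ := by
    refine Commute.sum_left _ _ _ fun i _ => ?_
    rw [commute_iff_eq, mul_assoc, hPσ, mul_smul_comm, ← mul_assoc, ← mul_assoc, hσP,
      smul_mul_assoc, smul_mul_assoc]
  have hBP : ∀ i ∈ s, B * P i = P i * A * P i := fun i hi => by
    rw [hB, Finset.sum_mul, Finset.sum_eq_single i]
    · rw [mul_assoc, hPP]
    · intro j _ hj
      rw [mul_assoc, hPP' j i hj, mul_zero]
    · exact fun h => absurd hi h
  have hPB : ∀ i ∈ s, P i * B = P i * A * P i := fun i hi => by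
    rw [hB, Finset.mul_sum, Finset.sum_eq_single i]
    · rw [← mul_assoc, ← mul_assoc, hPP]
    · intro j _ hj
      rw [← mul_assoc, ← mul_assoc, hPP' i j hj.symm, zero_mul, zero_mul]
    · exact fun h => absurd hi h
  have hB₀ : 0 ≤ B := Finset.sum_nonneg fun i _ => (hP i).conjugate_nonneg hA
  set H := B - γ • σ with hH
  have hHs : IsSelfAdjoint H :=
    (IsSelfAdjoint.of_nonneg hB₀).sub (IsSelfAdjoint.of_nonneg (smul_nonneg hγ.le hσ))
  set Q := cfc (fun x : ℝ => if 0 < x then 1 else 0) H with hQ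
  have hQs : IsSelfAdjoint Q := cfc_predicate _ _
  have hQQ : Q * Q = Q := by
    rw [hQ, ← cfc_mul _ _ H (continuousOn_spectrum _ H) (continuousOn_spectrum _ H)]
    exact cfc_congr fun x _ => by simp
  have hcomm : ∀ C, Commute H C → Commute Q C := fun C hC => hC.cfc_real _
  have hQσ : Commute Q σ := hcomm σ (hBσ.sub_left ((Commute.refl σ).smul_left γ))
  have hQP : ∀ i ∈ s, Commute Q (P i) := fun i hi => by
    refine hcomm _ (Commute.sub_left ?_ (Commute.smul_left ?_ γ))
    · rw [commute_iff_eq, hBP i hi, hPB i hi]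
    · rw [commute_iff_eq, hPσ, hσP]
  have hQH : Commute Q H := hcomm H (Commute.refl H)
  have hHQ : 0 ≤ H * Q := by
    conv_rhs => enter [1]; rw [← cfc_id' ℝ H]
    rw [hQ, ← cfc_mul _ _ H (continuousOn_spectrum _ H) (continuousOn_spectrum _ H)]
    refine cfc_nonneg fun x _ => ?_
    by_cases h : 0 < x
    · simp [h, h.le]
    · simp [h]
  have hHQ' : H ≤ H * Q := by
    conv_lhs => rw [← cfc_id' ℝ H]
    conv_rhs => enter [1]; rw [← cfc_id' ℝ H]
    rw [hQ, ← cfc_mul _ _ H (continuousOn_spectrum _ H) (continuousOn_spectrum _ H)]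
    refine cfc_mono (fun x _ => ?_) (continuousOn_spectrum _ H) (continuousOn_spectrum _ H)
    by_cases h : 0 < x
    · simp [h]
    · simp [h, not_lt.1 h]
  have hR : IsSelfAdjoint (1 - Q) := (IsSelfAdjoint.one _).sub hQs
  refine ⟨Q, hQs, hQQ, ?_, ?_⟩
  · have e : (A * Q).trace = (B * Q).trace := by
      rw [hB, Finset.sum_mul, Matrix.trace_sum]
      have : ∀ i ∈ s, (P i * A * P i * Q).trace = (A * Q * P i).trace := fun i hi => by
        rw [mul_assoc, ← (hQP i hi).eq, mul_assoc, Matrix.trace_mul_comm, mul_assoc, mul_assoc,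
          hPP, ← mul_assoc]
      rw [Finset.sum_congr rfl this, ← Matrix.trace_sum, ← Finset.mul_sum, hsum, mul_one]
    have := re_trace_nonneg hHQ
    rw [hH, sub_mul, smul_mul_assoc] at this
    simp [Matrix.trace_sub, Matrix.trace_smul] at this
    rwa [e]
  · have h₁ := hR.conjugate_le_conjugate (le_card_smul_sum_conj hP hsum hA)
    refine h₁.trans ?_
    rw [← hB, mul_smul_comm, smul_mul_assoc, hcard, mul_smul]
    refine smul_le_smul_of_nonneg_left ?_ (Nat.cast_nonneg _)
    have hRR : (1 - Q) * (1 - Q) = 1 - Q := by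
      rw [mul_sub, sub_mul _ _ Q, mul_one, one_mul, hQQ, sub_self, sub_zero]
    have h₂ : (1 - Q) * H * (1 - Q) ≤ 0 := by
      have : (1 - Q) * H * (1 - Q) = H - H * Q := by
        rw [((Commute.one_left H).sub_left hQH).eq, mul_assoc, hRR, mul_sub, mul_one]
      rw [this]
      exact sub_nonpos.2 hHQ'
    have h₃ : (1 - Q) * σ * (1 - Q) ≤ σ := by
      have : σ - (1 - Q) * σ * (1 - Q) = Q * σ * Q := by
        rw [((Commute.one_left σ).sub_left hQσ).eq, mul_assoc, hRR, hQσ.eq, mul_assoc, hQQ,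
          mul_sub, mul_one, sub_sub_cancel]
      rw [← sub_nonneg, this]
      exact hQs.conjugate_nonneg hσ
    rw [hH, mul_sub (1 - Q), sub_mul _ _ (1 - Q), mul_smul_comm, smul_mul_assoc, sub_nonpos] at h₂
    exact h₂.trans (smul_le_smul_of_nonneg_left h₃ hγ.le)

end Pinching
section Blocks

variable {Z E : Type*} [Fintype Z] [DecidableEq Z] [Fintype E] [DecidableEq E]

/-- The block-diagonal matrix `∑ z, |z⟩⟨z| ⊗ M z`. -/
noncomputable def directSum (M : Z → Matrix E E ℂ) : Matrix (Z × E) (Z × E) ℂ :=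
  ∑ z, Matrix.single z z (1 : ℂ) ⊗ₖ M z

/-- The diagonal block at `z`. -/
def block (M : Matrix (Z × E) (Z × E) ℂ) (z : Z) : Matrix E E ℂ :=
  M.submatrix (fun e => (z, e)) fun e => (z, e)

omit [Fintype E] [DecidableEq E] in
theorem directSum_apply (M : Z → Matrix E E ℂ) (a b : Z × E) :
    directSum M a b = if a.1 = b.1 then M a.1 a.2 b.2 else 0 := by
  rw [directSum, Matrix.sum_apply]
  simp only [Matrix.kroneckerMap_apply, Matrix.single_apply]
  split_ifs with h
  · rw [Finset.sum_eq_single a.1 (fun z _ hz => by simp [hz]) (by simp)]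
    simp [h]
  · refine Finset.sum_eq_zero fun z _ => ?_
    rw [if_neg (fun hz => h (hz.1.symm.trans hz.2)), zero_mul]

omit [Fintype E] [DecidableEq E] in
theorem block_directSum (M : Z → Matrix E E ℂ) (z : Z) : block (directSum M) z = M z := by
  ext i j
  simp [block, directSum_apply]

omit [DecidableEq E] in
theorem trace_directSum_mul (M : Z → Matrix E E ℂ) (K : Matrix (Z × E) (Z × E) ℂ) :
    (directSum M * K).trace = ∑ z, (M z * block K z).trace := by
  simp only [Matrix.trace, Matrix.diag_apply, Matrix.mul_apply, Fintype.sum_prod_type,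
    directSum_apply, block, Matrix.submatrix_apply]
  simp

omit [Fintype Z] [Fintype E] in
theorem block_one (z : Z) : block (1 : Matrix (Z × E) (Z × E) ℂ) z = 1 := by
  ext i j
  simp [block, Matrix.one_apply]

omit [Fintype Z] [DecidableEq Z] [Fintype E] [DecidableEq E] in
theorem block_nonneg {K : Matrix (Z × E) (Z × E) ℂ} (hK : 0 ≤ K) (z : Z) : 0 ≤ block K z :=
  Matrix.nonneg_iff_posSemidef.2 ((Matrix.nonneg_iff_posSemidef.1 hK).submatrix _)

omit [Fintype Z] [DecidableEq Z] [Fintype E] [DecidableEq E] in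
theorem block_mono {K L : Matrix (Z × E) (Z × E) ℂ} (h : K ≤ L) (z : Z) : block K z ≤ block L z :=
  sub_nonneg.1 (block_nonneg (sub_nonneg.2 h) z)

omit [Fintype E] in
theorem directSum_one : directSum (fun _ : Z => (1 : Matrix E E ℂ)) = 1 := by
  ext a b
  simp only [directSum_apply, Matrix.one_apply, Prod.ext_iff]
  split_ifs <;> simp_all

omit [DecidableEq E] in
theorem directSum_nonneg {M : Z → Matrix E E ℂ} (h : ∀ z, 0 ≤ M z) : 0 ≤ directSum M := by
  refine Finset.sum_nonneg fun z _ => Matrix.nonneg_iff_posSemidef.2 ?_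
  refine Matrix.PosSemidef.kronecker ?_ (Matrix.nonneg_iff_posSemidef.1 (h z))
  rw [← Matrix.diagonal_single]
  exact Matrix.PosSemidef.diagonal (Pi.single_nonneg.2 zero_le_one)

omit [Fintype E] [DecidableEq E] in
theorem directSum_sub (M N : Z → Matrix E E ℂ) :
    directSum (fun z => M z - N z) = directSum M - directSum N := by
  ext a b
  simp only [directSum_apply, Matrix.sub_apply]
  split_ifs <;> simp

omit [DecidableEq E] in
theorem directSum_mono {M N : Z → Matrix E E ℂ} (h : ∀ z, M z ≤ N z) :
    directSum M ≤ directSum N := by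
  rw [← sub_nonneg, ← directSum_sub]
  exact directSum_nonneg fun z => sub_nonneg.2 (h z)

end Blocks

section States

variable {X E : Type*} [Fintype X] [DecidableEq X] [Fintype E] [DecidableEq E]

/-- The subnormalized conditional state `p x • ρ_E^x`. -/
noncomputable def CQState.part {X E : Type*} [Fintype X] [Fintype E] (ρ : CQState X E) (x : X) :
    Matrix E E ℂ :=
  ρ.p x • ρ.state x

variable (ρ : CQState X E)

omit [DecidableEq X] [DecidableEq E] in
theorem CQState.part_nonneg (x : X) : 0 ≤ ρ.part x :=
  smul_nonneg (ρ.p_nonneg x) (Matrix.nonneg_iff_posSemidef.2 (ρ.state_posSemidef x))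

omit [DecidableEq X] [DecidableEq E] in
theorem CQState.part_eq (x : X) : (ρ.p x : ℂ) • ρ.state x = ρ.part x :=
  Complex.coe_smul _ _

omit [DecidableEq X] [DecidableEq E] in
theorem CQState.marginal_eq : ρ.marginal = ∑ x, ρ.part x := by
  simp only [CQState.marginal, ρ.part_eq]

omit [DecidableEq X] [DecidableEq E] in
theorem CQState.marginal_nonneg : 0 ≤ ρ.marginal := by
  rw [ρ.marginal_eq]
  exact Finset.sum_nonneg fun x _ => ρ.part_nonneg x

omit [DecidableEq X] [DecidableEq E] in
theorem CQState.sum_trace_part : ∑ x, (ρ.part x).trace = 1 := by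
  simp only [CQState.part, Matrix.trace_smul, ρ.state_trace]
  rw [← Finset.sum_smul, ρ.p_sum, one_smul]

omit [DecidableEq X] [DecidableEq E] in
theorem CQState.trace_marginal : ρ.marginal.trace = 1 := by
  rw [ρ.marginal_eq, Matrix.trace_sum, ρ.sum_trace_part]

omit [DecidableEq X] [DecidableEq E] in
theorem CQState.nonempty_right (ρ : CQState X E) : Nonempty E := by
  by_contra hE
  rw [not_nonempty_iff] at hE
  simpa [Matrix.trace] using ρ.trace_marginal

omit [DecidableEq E] in
theorem CQState.joint_eq : ρ.joint = directSum ρ.part := by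
  simp only [CQState.joint, directSum, ← Matrix.kronecker_smul, ρ.part_eq]

variable {Z : Type*} [Fintype Z] [DecidableEq Z]

omit [Fintype E] [DecidableEq E] in
theorem one_kronecker_eq (σ : Matrix E E ℂ) :
    (1 : Matrix Z Z ℂ) ⊗ₖ σ = directSum fun _ => σ := by
  ext a b
  simp [directSum_apply, Matrix.one_apply]

omit [DecidableEq X] [DecidableEq E] in
theorem CQState.hashed_sub_ideal (f : X → Z) :
    ρ.hashed f - ρ.ideal Z = directSum fun z =>
      ∑ x, ((if f x = z then 1 else 0) - (Fintype.card Z : ℝ)⁻¹) • ρ.part x := by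
  ext a b
  simp only [CQState.hashed, CQState.ideal, ρ.marginal_eq, directSum_apply, Matrix.sub_apply,
    Matrix.sum_apply, ← Matrix.kronecker_smul, ρ.part_eq, Matrix.kroneckerMap_apply,
    Matrix.single_apply, Matrix.smul_apply, Matrix.one_apply]
  by_cases h : a.1 = b.1
  · simp [h, sub_mul, Finset.mul_sum]
    exact Finset.sum_congr rfl fun x _ => by split_ifs <;> simp
  · have : ∀ x, ¬ (f x = a.1 ∧ f x = b.1) := fun x hx => h (hx.1.symm.trans hx.2)
    simp [h, this]

omit [DecidableEq X] [DecidableEq E] in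
theorem CQState.re_trace_hashed_sub_ideal_mul (f : X → Z) (K : Matrix (Z × E) (Z × E) ℂ) :
    ((ρ.hashed f - ρ.ideal Z) * K).trace.re =
      ∑ z, ∑ x, ((if f x = z then 1 else 0) - (Fintype.card Z : ℝ)⁻¹) *
        (ρ.part x * block K z).trace.re := by
  rw [ρ.hashed_sub_ideal, trace_directSum_mul, Complex.re_sum]
  refine Finset.sum_congr rfl fun z _ => ?_
  rw [Finset.sum_mul, Matrix.trace_sum, Complex.re_sum]
  refine Finset.sum_congr rfl fun x _ => ?_
  rw [smul_mul_assoc, Matrix.trace_smul, Complex.smul_re, smul_eq_mul]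

omit [DecidableEq X] [DecidableEq E] in
theorem CQState.isSelfAdjoint_hashed_sub_ideal (f : X → Z) :
    IsSelfAdjoint (ρ.hashed f - ρ.ideal Z) := by
  refine IsSelfAdjoint.sub (IsSelfAdjoint.of_nonneg ?_) (IsSelfAdjoint.of_nonneg ?_)
  · refine Finset.sum_nonneg fun x _ => ?_
    rw [← Matrix.kronecker_smul, ρ.part_eq]
    refine Matrix.nonneg_iff_posSemidef.2 (Matrix.PosSemidef.kronecker ?_
      (Matrix.nonneg_iff_posSemidef.1 (ρ.part_nonneg x)))
    rw [← Matrix.diagonal_single]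
    exact Matrix.PosSemidef.diagonal (Pi.single_nonneg.2 zero_le_one)
  · refine Matrix.nonneg_iff_posSemidef.2 (Matrix.PosSemidef.kronecker ?_
      (Matrix.nonneg_iff_posSemidef.1 ρ.marginal_nonneg))
    refine Matrix.PosSemidef.one.smul ?_
    positivity

end States

section Converse

variable {X E : Type*} [Fintype X] [DecidableEq X] [Fintype E] [DecidableEq E]
variable {Z : Type*} [Fintype Z] [DecidableEq Z]

theorem sum_toReal_eq_one {α : Type*} [Fintype α] (h : PMF α) : ∑ a, (h a).toReal = 1 := by
  rw [← ENNReal.toReal_sum fun a _ => h.apply_ne_top a, ← tsum_fintype (L := .unconditional _),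
    h.tsum_coe, ENNReal.toReal_one]

/-- Every test between `ρ_XE` and `1 ⊗ ρ_E` yields a test between the hashed and the ideal state. -/
theorem CQState.le_half_traceNorm [Nonempty Z] (ρ : CQState X E) (f : X → Z)
    {T : Matrix (X × E) (X × E) ℂ} (hT₀ : 0 ≤ T) (hT₁ : T ≤ 1) {c : ℝ} (hc : 0 < c) :
    (1 + c)⁻¹ * (ρ.joint * T).trace.re -
        (Fintype.card Z : ℝ)⁻¹ * c⁻¹ * (((1 : Matrix X X ℂ) ⊗ₖ ρ.marginal) * T).trace.re ≤
      1 / 2 * traceNorm (ρ.hashed f - ρ.ideal Z) := by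
  set S : Z → Matrix E E ℂ := fun z => ∑ x with f x = z, block T x with hS
  have hB₀ : ∀ x, 0 ≤ block T x := block_nonneg hT₀
  have hB₁ : ∀ x, block T x ≤ 1 := fun x => (block_mono hT₁ x).trans_eq (block_one x)
  have hS₀ : ∀ z, 0 ≤ S z := fun z => Finset.sum_nonneg fun x _ => hB₀ x
  choose M hM₀ hM₁ hMS hTM using fun z => exists_test_of_nonneg (hS₀ z) hc
  have hle : ∀ x, (1 + c)⁻¹ • block T x ≤ M (f x) := fun x =>
    hTM (f x) _ (hB₀ x) (hB₁ x)
      (Finset.single_le_sum (f := fun x => block T x) (fun y _ => hB₀ y) (by simp))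
  have hm : (Fintype.card Z : ℝ) ≠ 0 := Nat.cast_ne_zero.2 Fintype.card_ne_zero
  have key : ∀ N : Z → Matrix E E ℂ,
      ((ρ.hashed f - ρ.ideal Z) * directSum N).trace.re =
        ∑ x, (ρ.part x * N (f x)).trace.re -
          (Fintype.card Z : ℝ)⁻¹ * ∑ z, (ρ.marginal * N z).trace.re := fun N => by
    rw [ρ.re_trace_hashed_sub_ideal_mul]
    simp only [block_directSum, sub_mul, Finset.sum_sub_distrib, ρ.marginal_eq, Finset.sum_mul,
      Matrix.trace_sum, Complex.re_sum, Finset.mul_sum, ite_mul, one_mul, zero_mul]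
    rw [Finset.sum_comm]
    simp
  have h1 := re_trace_mul_le_traceNorm (ρ.isSelfAdjoint_hashed_sub_ideal f)
    (K := directSum fun z => M z - (1 - M z)) (by
      rw [directSum_sub, directSum_sub, directSum_one]
      have := directSum_nonneg hM₀
      have h : -1 + 0 ≤ -1 + (directSum M + directSum M) :=
        add_le_add_right (add_nonneg this this) _
      rw [add_zero] at h
      exact h.trans_eq (by abel)) (by
      rw [directSum_sub, directSum_sub, directSum_one]
      have : directSum M ≤ 1 := (directSum_mono hM₁).trans_eq directSum_one
      have h : directSum M - (1 - directSum M) ≤ 1 - (1 - 1) := by gcongr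
      exact h.trans_eq (by simp))
  have h2 : ((ρ.hashed f - ρ.ideal Z) * directSum fun z => M z - (1 - M z)).trace.re =
      2 * ((ρ.hashed f - ρ.ideal Z) * directSum M).trace.re := by
    have h0 := key fun _ => 1
    simp only [mul_one, Finset.sum_const, ← Complex.re_sum, ρ.sum_trace_part, ρ.trace_marginal,
      Complex.one_re, Finset.card_univ, nsmul_eq_mul, inv_mul_cancel₀ hm, sub_self,
      directSum_one] at h0
    rw [directSum_sub, directSum_sub, directSum_one, mul_sub, mul_sub, Matrix.trace_sub,
      Matrix.trace_sub, Complex.sub_re, Complex.sub_re, mul_one, h0]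
    ring
  rw [h2, key] at h1
  have h3 : (1 + c)⁻¹ * (ρ.joint * T).trace.re ≤ ∑ x, (ρ.part x * M (f x)).trace.re := by
    rw [ρ.joint_eq, trace_directSum_mul, Complex.re_sum, Finset.mul_sum]
    refine Finset.sum_le_sum fun x _ => ?_
    refine le_trans (le_of_eq ?_) (re_trace_mul_mono (ρ.part_nonneg x) (hle x))
    rw [mul_smul_comm, Matrix.trace_smul, Complex.smul_re, smul_eq_mul]
  have h4 : ∑ z, (ρ.marginal * M z).trace.re ≤
      c⁻¹ * (((1 : Matrix X X ℂ) ⊗ₖ ρ.marginal) * T).trace.re := by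
    have e : (((1 : Matrix X X ℂ) ⊗ₖ ρ.marginal) * T).trace.re =
        ∑ z, (ρ.marginal * S z).trace.re := by
      rw [one_kronecker_eq, trace_directSum_mul, Complex.re_sum]
      simp only [hS, Finset.mul_sum, Matrix.trace_sum, Complex.re_sum]
      exact (Finset.sum_fiberwise _ f _).symm
    rw [e, Finset.mul_sum]
    refine Finset.sum_le_sum fun z _ => ?_
    refine (re_trace_mul_mono ρ.marginal_nonneg (hMS z)).trans (le_of_eq ?_)
    rw [mul_smul_comm, Matrix.trace_smul, Complex.smul_re, smul_eq_mul]
  have h5 := mul_le_mul_of_nonneg_left h4 (show 0 ≤ (Fintype.card Z : ℝ)⁻¹ by positivity)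
  rw [mul_assoc]
  linarith

theorem CQState.le_insecurity [Nonempty Z] (ρ : CQState X E) (h : PMF (X → Z))
    {T : Matrix (X × E) (X × E) ℂ} (hT₀ : 0 ≤ T) (hT₁ : T ≤ 1) {c : ℝ} (hc : 0 < c) :
    (1 + c)⁻¹ * (ρ.joint * T).trace.re -
        (Fintype.card Z : ℝ)⁻¹ * c⁻¹ * (((1 : Matrix X X ℂ) ⊗ₖ ρ.marginal) * T).trace.re ≤
      ρ.insecurity h := by
  refine (one_mul _).symm.trans_le ?_
  rw [CQState.insecurity, Finset.mul_sum]
  nth_rw 1 [← sum_toReal_eq_one h]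
  rw [Finset.sum_mul]
  refine Finset.sum_le_sum fun f _ => ?_
  rw [mul_left_comm]
  exact mul_le_mul_of_nonneg_left (ρ.le_half_traceNorm f hT₀ hT₁ hc) ENNReal.toReal_nonneg

/-- One-shot converse: a hash function with range of size `m` that is `ε`-secret bounds `m`. -/
theorem CQState.card_le_of_insecurity_le [Nonempty Z] (ρ : CQState X E) (h : PMF (X → Z))
    {ε δ c : ℝ} (hε1 : ε < 1) (hc : 0 < c) (hcδ : c < δ) (hδ : 3 * δ < ε)
    (hh : ρ.insecurity h ≤ ε)
    {T : Matrix (X × E) (X × E) ℂ} (hT₀ : 0 ≤ T) (hT₁ : T ≤ 1)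
    (hT : ε + 2 * δ ≤ (ρ.joint * T).trace.re) :
    (Fintype.card Z : ℝ) ≤ (((1 : Matrix X X ℂ) ⊗ₖ ρ.marginal) * T).trace.re *
      ((1 + c) / (c * δ)) * ((ε + c) / (δ - c)) := by
  have h1 := (ρ.le_insecurity h hT₀ hT₁ hc).trans hh
  set t := (((1 : Matrix X X ℂ) ⊗ₖ ρ.marginal) * T).trace.re
  have hm : (0 : ℝ) < Fintype.card Z := Nat.cast_pos.2 Fintype.card_pos
  have h2 := mul_le_mul_of_nonneg_left hT (show 0 ≤ (1 + c)⁻¹ by positivity)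
  set m := (Fintype.card Z : ℝ)
  have h3 : (1 + c)⁻¹ * (ε + 2 * δ) - ε ≤ m⁻¹ * c⁻¹ * t := by linarith
  have hcε : c * ε ≤ δ := by nlinarith
  have h4 : (1 + c)⁻¹ * δ ≤ (1 + c)⁻¹ * (ε + 2 * δ) - ε := by
    have : (1 + c)⁻¹ * (ε + 2 * δ) - ε = (1 + c)⁻¹ * (2 * δ - c * ε) := by field_simp; ring
    rw [this]
    exact mul_le_mul_of_nonneg_left (by linarith) (by positivity)
  have hδ0 : 0 < δ := hc.trans hcδ
  have hdc : 0 < δ - c := by linarith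
  have h5 : m * δ ≤ t * ((1 + c) / c) := by
    have := mul_le_mul_of_nonneg_left (h4.trans h3) (show 0 ≤ m * (1 + c) by positivity)
    calc m * δ = m * (1 + c) * ((1 + c)⁻¹ * δ) := by field_simp
      _ ≤ _ := this
      _ = _ := by field_simp
  have h6 : m ≤ t * ((1 + c) / (c * δ)) := by
    calc m = m * δ / δ := by field_simp
      _ ≤ t * ((1 + c) / c) / δ := by gcongr
      _ = _ := by field_simp
  refine h6.trans (le_mul_of_one_le_right (hm.le.trans h6) ?_)
  rw [one_le_div hdc]
  linarith

end Converse
section Universal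

variable {X Z : Type*} [Fintype X] [DecidableEq X] [Fintype Z] [DecidableEq Z]

theorem IsStronglyTwoUniversal.sum_eq {h : PMF (X → Z)} (hh : IsStronglyTwoUniversal h)
    {x x' : X} (hx : x ≠ x') (z z' : Z) :
    ∑ f : X → Z, (h f).toReal * ((if f x = z then 1 else 0) * (if f x' = z' then 1 else 0)) =
      ((Fintype.card Z : ℝ) ^ 2)⁻¹ := by
  have h1 := congrArg ENNReal.toReal (hh x x' hx z z')
  rw [PMF.toOuterMeasure_apply_fintype, ENNReal.toReal_sum] at h1
  · simp only [one_div, ENNReal.toReal_inv, ENNReal.toReal_pow, ENNReal.toReal_natCast] at h1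
    rw [← h1]
    refine Finset.sum_congr rfl fun f _ => ?_
    by_cases h₁ : f x = z <;> by_cases h₂ : f x' = z' <;> simp [Set.indicator, h₁, h₂]
  · intro f _
    exact ((Set.indicator_le_self _ _ f).trans_lt (h.apply_lt_top f)).ne

theorem IsStronglyTwoUniversal.sum_single_eq [Nontrivial X] [Nonempty Z] {h : PMF (X → Z)}
    (hh : IsStronglyTwoUniversal h) (x : X) (z : Z) :
    ∑ f : X → Z, (h f).toReal * (if f x = z then 1 else 0) = (Fintype.card Z : ℝ)⁻¹ := by
  obtain ⟨x', hx⟩ := exists_ne x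
  have h1 : ∑ z' : Z, ((Fintype.card Z : ℝ) ^ 2)⁻¹ = (Fintype.card Z : ℝ)⁻¹ := by
    have : (Fintype.card Z : ℝ) ≠ 0 := Nat.cast_ne_zero.2 Fintype.card_ne_zero
    rw [Finset.sum_const, Finset.card_univ, nsmul_eq_mul]
    field_simp
  rw [← h1, Finset.sum_congr rfl fun z' _ => (hh.sum_eq hx.symm z z').symm, Finset.sum_comm]
  refine Finset.sum_congr rfl fun f _ => ?_
  rw [← Finset.mul_sum, ← Finset.mul_sum]
  simp

/-- The centered indicator of the event `f x = z`. -/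
noncomputable def deviation (z : Z) (f : X → Z) (x : X) : ℝ :=
  (if f x = z then 1 else 0) - (Fintype.card Z : ℝ)⁻¹

theorem IsStronglyTwoUniversal.sum_abs_deviation_le [Nontrivial X] [Nonempty Z] {h : PMF (X → Z)}
    (hh : IsStronglyTwoUniversal h) (x : X) (z : Z) :
    ∑ f : X → Z, (h f).toReal * |deviation z f x| ≤ 2 * (Fintype.card Z : ℝ)⁻¹ := by
  calc ∑ f : X → Z, (h f).toReal * |deviation z f x|
      ≤ ∑ f : X → Z, ((h f).toReal * (if f x = z then 1 else 0) +
          (h f).toReal * (Fintype.card Z : ℝ)⁻¹) := by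
        refine Finset.sum_le_sum fun f _ => ?_
        rw [← mul_add]
        refine mul_le_mul_of_nonneg_left ((abs_sub _ _).trans_eq ?_) ENNReal.toReal_nonneg
        rw [abs_of_nonneg (by split_ifs <;> norm_num), abs_of_nonneg (by positivity)]
    _ = _ := by
        rw [Finset.sum_add_distrib, hh.sum_single_eq, ← Finset.sum_mul, sum_toReal_eq_one]
        ring

theorem IsStronglyTwoUniversal.sum_deviation_mul [Nontrivial X] [Nonempty Z] {h : PMF (X → Z)}
    (hh : IsStronglyTwoUniversal h) {x x' : X} (hx : x ≠ x') (z : Z) :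
    ∑ f : X → Z, (h f).toReal * (deviation z f x * deviation z f x') = 0 := by
  have e : ∀ f : X → Z, (h f).toReal * (deviation z f x * deviation z f x') =
      (h f).toReal * ((if f x = z then 1 else 0) * (if f x' = z then 1 else 0)) -
      (Fintype.card Z : ℝ)⁻¹ * ((h f).toReal * (if f x = z then 1 else 0)) -
      (Fintype.card Z : ℝ)⁻¹ * ((h f).toReal * (if f x' = z then 1 else 0)) +
      (Fintype.card Z : ℝ)⁻¹ ^ 2 * (h f).toReal := fun f => by
    rw [deviation, deviation]; ring
  simp only [e, Finset.sum_add_distrib, Finset.sum_sub_distrib, ← Finset.mul_sum,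
    hh.sum_eq hx, hh.sum_single_eq, sum_toReal_eq_one]
  ring

theorem IsStronglyTwoUniversal.sum_deviation_sq_le [Nontrivial X] [Nonempty Z] {h : PMF (X → Z)}
    (hh : IsStronglyTwoUniversal h) (x : X) (z : Z) :
    ∑ f : X → Z, (h f).toReal * (deviation z f x * deviation z f x) ≤
      (Fintype.card Z : ℝ)⁻¹ := by
  have e : ∀ f : X → Z, (h f).toReal * (deviation z f x * deviation z f x) =
      (1 - 2 * (Fintype.card Z : ℝ)⁻¹) * ((h f).toReal * (if f x = z then 1 else 0)) +
      (Fintype.card Z : ℝ)⁻¹ ^ 2 * (h f).toReal := fun f => by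
    rw [deviation]; split_ifs <;> ring
  simp only [e, Finset.sum_add_distrib, ← Finset.mul_sum, hh.sum_single_eq, sum_toReal_eq_one]
  nlinarith [sq_nonneg (Fintype.card Z : ℝ)⁻¹]

omit [DecidableEq Z] in
/-- The uniform distribution on all functions is strongly 2-universal. -/
theorem isStronglyTwoUniversal_uniform [Nonempty Z] :
    IsStronglyTwoUniversal (PMF.uniformOfFintype (X → Z)) := by
  intro x x' hx z z'
  classical
  set g : X → Finset Z := fun y => if y = x then {z} else if y = x' then {z'} else Finset.univ
    with hg
  have e : {f : X → Z | f x = z ∧ f x' = z'} = (Fintype.piFinset g : Set (X → Z)) := by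
    ext f
    simp only [Set.mem_ofPred_eq, Finset.mem_coe, Fintype.mem_piFinset, hg]
    constructor
    · rintro ⟨h₁, h₂⟩ y
      by_cases hy : y = x
      · simp [hy, h₁]
      · by_cases hy' : y = x'
        · simp [hy', hx.symm, h₂]
        · simp [hy, hy']
    · intro h
      exact ⟨by simpa using h x, by simpa [hx.symm] using h x'⟩
  have hcard : (Fintype.piFinset g).card * Fintype.card Z ^ 2 = Fintype.card (X → Z) := by
    have h1 : ∀ y, (g y).card * ((if y = x then Fintype.card Z else 1) *
        (if y = x' then Fintype.card Z else 1)) = Fintype.card Z := fun y => by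
      by_cases hy : y = x
      · simp [hg, hy, hx]
      · by_cases hy' : y = x' <;> simp [hg, hy, hy', hx.symm]
    have h2 := Finset.prod_congr (s₁ := Finset.univ) rfl fun y _ => h1 y
    rw [Finset.prod_mul_distrib, Finset.prod_mul_distrib, Finset.prod_ite_eq',
      Finset.prod_ite_eq', Finset.prod_const, if_pos (Finset.mem_univ _),
      if_pos (Finset.mem_univ _), Finset.card_univ] at h2
    rw [Fintype.card_piFinset, sq, h2, Fintype.card_fun]
  rw [e, PMF.toOuterMeasure_uniformOfFintype_apply, ← hcard]
  simp only [Finset.coe_sort_coe, Fintype.card_coe, Nat.cast_mul, Nat.cast_pow]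
  have h0 : ((Fintype.piFinset g).card : ℝ≥0∞) ≠ 0 := by
    intro h
    rw [Nat.cast_eq_zero] at h
    rw [h, zero_mul] at hcard
    exact Fintype.card_ne_zero hcard.symm
  rw [← ENNReal.mul_div_mul_left 1 _ h0 (ENNReal.natCast_ne_top _), mul_one]

end Universal

section Achievability

variable {X E : Type*} [Fintype X] [DecidableEq X] [Fintype E] [DecidableEq E]
variable {Z : Type*} [Fintype Z] [DecidableEq Z]

theorem re_trace_mul_eq_of_isSelfAdjoint {A Q K : Matrix E E ℂ} (hA : IsSelfAdjoint A)
    (hQ : IsSelfAdjoint Q) (hK : IsSelfAdjoint K) :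
    (A * K).trace.re = (Q * A * Q * K).trace.re + ((1 + Q) * A * (1 - Q) * K).trace.re := by
  have e : A * K = Q * A * Q * K + (1 + Q) * A * (1 - Q) * K + ((1 - Q) * A * K
    - A * (1 - Q) * K) := by noncomm_ring
  have c : ((1 - Q) * A * K).trace.re = (A * (1 - Q) * K).trace.re := by
    have : star ((1 - Q) * A * K) = K * (A * (1 - Q)) := by
      simp only [star_mul, star_sub, star_one, hA.star_eq, hQ.star_eq, hK.star_eq]
    have h := congrArg (fun M => (Matrix.trace M).re) this
    simp only [Matrix.star_eq_conjTranspose, Matrix.trace_conjTranspose] at h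
    rw [Matrix.trace_mul_comm K] at h
    simpa using h
  rw [e]
  simp only [Matrix.trace_add, Matrix.trace_sub, Complex.add_re, Complex.sub_re, c]
  ring

theorem re_trace_quadratic_le {A Q τ : Matrix E E ℂ} (hA : 0 ≤ A) (hQ : IsSelfAdjoint Q)
    (hQQ : Q * Q = Q) (hτ : τ.PosDef) {k : ℝ} (hk : 0 < k)
    (h : (1 - Q) * A * (1 - Q) ≤ k • τ) :
    ((1 + Q) * A * (1 - Q) * τ⁻¹ * star ((1 + Q) * A * (1 - Q))).trace.re ≤
      4 * k * A.trace.re := by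
  have hR : IsSelfAdjoint (1 - Q) := (IsSelfAdjoint.one _).sub hQ
  have hP : IsSelfAdjoint (1 + Q) := (IsSelfAdjoint.one _).add hQ
  have h1 := hP.conjugate_le_conjugate (mul_inv_mul_le_smul hA hR hτ hk h)
  have h2 := re_trace_mono h1
  have e1 : (1 + Q) * A * (1 - Q) * τ⁻¹ * star ((1 + Q) * A * (1 - Q)) =
      (1 + Q) * (A * (1 - Q) * τ⁻¹ * (1 - Q) * A) * (1 + Q) := by
    simp only [star_mul, hR.star_eq, hP.star_eq, (IsSelfAdjoint.of_nonneg hA).star_eq, mul_assoc]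
  rw [e1]
  refine h2.trans ?_
  rw [mul_smul_comm, smul_mul_assoc, Matrix.trace_smul, Complex.smul_re, smul_eq_mul,
    mul_comm 4 k, mul_assoc k]
  refine mul_le_mul_of_nonneg_left ?_ hk.le
  have e2 : (1 + Q) * (1 + Q) = (4 : ℝ) • 1 - (3 : ℝ) • (1 - Q) := by
    have : (1 + Q) * (1 + Q) = 1 + Q + Q + Q * Q := by noncomm_ring
    rw [this, hQQ]; module
  have hR0 : 0 ≤ 1 - Q := by
    have : 1 - Q = star (1 - Q) * (1 - Q) := by
      rw [hR.star_eq, mul_sub, sub_mul _ _ Q, mul_one, one_mul, hQQ, sub_self, sub_zero]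
    rw [this]; exact star_mul_self_nonneg _
  have h3 := re_trace_mul_nonneg hA hR0
  rw [mul_assoc, Matrix.trace_mul_comm, mul_assoc, e2, mul_sub, mul_smul_comm, mul_smul_comm,
    mul_one, Matrix.trace_sub, Matrix.trace_smul, Matrix.trace_smul]
  simp only [Complex.sub_re, Complex.smul_re, smul_eq_mul]
  linarith

omit [DecidableEq X] in
/-- Bound on the distance to the ideal state for a fixed hash function. -/
theorem CQState.traceNorm_le (ρ : CQState X E) (f : X → Z) {Q : X → Matrix E E ℂ}
    (hQ : ∀ x, IsSelfAdjoint (Q x)) (hQQ : ∀ x, Q x * Q x = Q x) {τ : Matrix E E ℂ}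
    (hτ : τ.PosDef) (hτ2 : τ.trace.re ≤ 2) {l : ℝ} (hl : 0 < l) :
    traceNorm (ρ.hashed f - ρ.ideal Z) ≤
      ∑ z, (∑ x, |deviation z f x| * (ρ.part x * Q x).trace.re +
        l / 2 * (∑ x, ∑ x', deviation z f x * deviation z f x' *
          ((1 + Q x) * ρ.part x * (1 - Q x) * τ⁻¹ *
            star ((1 + Q x') * ρ.part x' * (1 - Q x'))).trace.re) + l⁻¹) := by
  obtain ⟨K, hK, hK₁, hK₂, e⟩ := exists_traceNorm_eq (ρ.isSelfAdjoint_hashed_sub_ideal f)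
  rw [e, ρ.re_trace_hashed_sub_ideal_mul]
  refine Finset.sum_le_sum fun z _ => ?_
  set L := block K z
  have hL₂ : L ≤ 1 := (block_mono hK₂ z).trans_eq (block_one z)
  have hL₁ : -1 ≤ L := by
    refine le_trans (le_of_eq ?_) (block_mono hK₁ z)
    rw [← block_one z]; rfl
  have hL : IsSelfAdjoint L := by
    have := (IsSelfAdjoint.of_nonneg (sub_nonneg.2 hL₂))
    simpa using (IsSelfAdjoint.one _).sub this
  set B : X → Matrix E E ℂ := fun x => (1 + Q x) * ρ.part x * (1 - Q x) with hB
  have h1 : ∀ x, ((if f x = z then 1 else 0) - (Fintype.card Z : ℝ)⁻¹) *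
      (ρ.part x * L).trace.re ≤ |deviation z f x| * (ρ.part x * Q x).trace.re +
        deviation z f x * (B x * L).trace.re := fun x => by
    rw [re_trace_mul_eq_of_isSelfAdjoint (IsSelfAdjoint.of_nonneg (ρ.part_nonneg x)) (hQ x) hL,
      mul_add]
    refine add_le_add_left ?_ _
    have p := (hQ x).conjugate_nonneg (ρ.part_nonneg x)
    have e : (ρ.part x * Q x).trace.re = (Q x * ρ.part x * Q x).trace.re := by
      rw [mul_assoc, Matrix.trace_mul_comm (Q x), mul_assoc, hQQ]
    have q₁ := re_trace_mul_mono p hL₂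
    have q₂ := re_trace_mul_mono p hL₁
    rw [mul_neg, mul_one, Matrix.trace_neg, Complex.neg_re, ← e] at q₂
    rw [mul_one, ← e] at q₁
    refine (le_abs_self _).trans ?_
    rw [abs_mul]
    exact mul_le_mul_of_nonneg_left (abs_le.2 ⟨q₂, q₁⟩) (abs_nonneg _)
  refine (Finset.sum_le_sum fun x _ => h1 x).trans ?_
  rw [Finset.sum_add_distrib, add_assoc]
  refine add_le_add_right ?_ _
  have h2 := two_mul_re_trace_mul_le (Y := ∑ x, deviation z f x • B x) hτ hL hl
  have e1 : ((∑ x, deviation z f x • B x) * L).trace.re =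
      ∑ x, deviation z f x * (B x * L).trace.re := by
    simp [Finset.sum_mul, Matrix.trace_sum, Matrix.trace_smul]
  have e2 : ((∑ x, deviation z f x • B x) * τ⁻¹ * star (∑ x, deviation z f x • B x)).trace.re =
      ∑ x, ∑ x', deviation z f x * deviation z f x' * (B x * τ⁻¹ * star (B x')).trace.re := by
    simp only [Finset.sum_mul, star_sum, star_smul, star_trivial, Finset.mul_sum, smul_mul_assoc,
      mul_smul_comm, Matrix.trace_sum, Matrix.trace_smul, Complex.re_sum, Complex.smul_re,
      smul_eq_mul]
    rw [Finset.sum_comm]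
    exact Finset.sum_congr rfl fun x _ => Finset.sum_congr rfl fun x' _ => by ring
  have h3 : (L * τ * L).trace.re ≤ 2 := by
    rw [mul_assoc, Matrix.trace_mul_comm, mul_assoc]
    refine (re_trace_mul_mono (Matrix.nonneg_iff_posSemidef.2 hτ.posSemidef)
      (mul_self_le_one hL₁ hL₂)).trans ?_
    rwa [mul_one]
  rw [e1, e2] at h2
  have h4 := mul_le_mul_of_nonneg_left h3 (inv_nonneg.2 hl.le)
  linarith

/-- One-shot achievability: security of strongly 2-universal hashing, given tests that bound the
conditional states. -/
theorem CQState.insecurity_le [Nontrivial X] [Nonempty Z] (ρ : CQState X E) {h : PMF (X → Z)}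
    (hh : IsStronglyTwoUniversal h) {Q : X → Matrix E E ℂ}
    (hQ : ∀ x, IsSelfAdjoint (Q x)) (hQQ : ∀ x, Q x * Q x = Q x) {k : ℝ} (hk : 0 < k)
    (hkQ : ∀ x, (1 - Q x) * ρ.part x * (1 - Q x) ≤ k • ρ.marginal) {δ : ℝ} (hδ : 0 < δ) :
    ρ.insecurity h ≤ ∑ x, (ρ.part x * Q x).trace.re + Fintype.card Z * k / δ + δ / 2 := by
  have hE := ρ.nonempty_right
  have hcE : (0 : ℝ) < Fintype.card E := Nat.cast_pos.2 Fintype.card_pos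
  have hm : (0 : ℝ) < Fintype.card Z := Nat.cast_pos.2 Fintype.card_pos
  set m := (Fintype.card Z : ℝ) with hm_def
  have hκ : 0 < (Fintype.card E : ℝ)⁻¹ := inv_pos.2 hcE
  set τ := ρ.marginal + (Fintype.card E : ℝ)⁻¹ • 1 with hτ_def
  have hτ : τ.PosDef := (Matrix.PosDef.one.smul hκ).posSemidef_add
    (Matrix.nonneg_iff_posSemidef.1 ρ.marginal_nonneg)
  have hτ2 : τ.trace.re ≤ 2 := by
    rw [hτ_def, Matrix.trace_add, ρ.trace_marginal, Matrix.trace_smul, Matrix.trace_one]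
    simp
    norm_num
  have hστ : ρ.marginal ≤ τ := le_add_of_nonneg_right (smul_nonneg hκ.le zero_le_one)
  set l := m / δ with hl_def
  have hl : 0 < l := div_pos hm hδ
  set G : X → X → ℝ := fun x x' => ((1 + Q x) * ρ.part x * (1 - Q x) * τ⁻¹ *
            star ((1 + Q x') * ρ.part x' * (1 - Q x'))).trace.re with hG
  have hGx : ∀ x, G x x ≤ 4 * k * (ρ.part x).trace.re := fun x =>
    re_trace_quadratic_le (ρ.part_nonneg x) (hQ x) (hQQ x) hτ hk
      ((hkQ x).trans (smul_le_smul_of_nonneg_left hστ hk.le))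
  have hGx0 : ∀ x, 0 ≤ G x x := fun x => re_trace_nonneg
    (star_right_conjugate_nonneg (Matrix.nonneg_iff_posSemidef.2 hτ.inv.posSemidef) _)
  have hb : ∀ x, 0 ≤ (ρ.part x * Q x).trace.re := fun x => by
    rw [← hQQ x, ← mul_assoc, Matrix.trace_mul_comm, ← mul_assoc]
    exact re_trace_nonneg ((hQ x).conjugate_nonneg (ρ.part_nonneg x))
  have key : ∀ z, ∑ f : X → Z, (h f).toReal *
      (∑ x, |deviation z f x| * (ρ.part x * Q x).trace.re +
        l / 2 * (∑ x, ∑ x', deviation z f x * deviation z f x' * G x x') + l⁻¹) ≤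
      2 * m⁻¹ * ∑ x, (ρ.part x * Q x).trace.re + 2 * l * m⁻¹ * k + l⁻¹ := fun z => by
    simp only [mul_add, Finset.sum_add_distrib, ← Finset.sum_mul, sum_toReal_eq_one, one_mul]
    refine add_le_add (add_le_add ?_ ?_) le_rfl
    · simp only [Finset.mul_sum]
      rw [Finset.sum_comm]
      refine Finset.sum_le_sum fun x _ => ?_
      simp only [← mul_assoc]
      rw [← Finset.sum_mul]
      exact mul_le_mul_of_nonneg_right (hh.sum_abs_deviation_le x z) (hb x)
    · have e : ∑ f : X → Z, (h f).toReal * (l / 2 *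
          (∑ x, ∑ x', deviation z f x * deviation z f x' * G x x')) =
          l / 2 * ∑ x, ∑ x', (∑ f : X → Z,
            (h f).toReal * (deviation z f x * deviation z f x')) * G x x' := by
        simp only [Finset.mul_sum, Finset.sum_mul]
        rw [Finset.sum_comm]
        refine Finset.sum_congr rfl fun x _ => ?_
        rw [Finset.sum_comm]
        exact Finset.sum_congr rfl fun x' _ => Finset.sum_congr rfl fun f _ => by ring
      rw [e]
      have h1 : ∑ x, ∑ x', (∑ f : X → Z,
          (h f).toReal * (deviation z f x * deviation z f x')) * G x x' ≤
          ∑ x, m⁻¹ * (4 * k * (ρ.part x).trace.re) := by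
        refine Finset.sum_le_sum fun x _ => ?_
        rw [Finset.sum_eq_single x (fun x' _ hx' => by
          rw [hh.sum_deviation_mul hx'.symm, zero_mul]) (by simp)]
        exact mul_le_mul (hh.sum_deviation_sq_le x z) (hGx x) (hGx0 x) (by positivity)
      have h2 : ∑ x, m⁻¹ * (4 * k * (ρ.part x).trace.re) = m⁻¹ * (4 * k) := by
        simp only [← Finset.mul_sum, ← Complex.re_sum, ρ.sum_trace_part, Complex.one_re, mul_one]
      have := mul_le_mul_of_nonneg_left (h1.trans_eq h2) (show 0 ≤ l / 2 by positivity)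
      linarith
  have h5 : ∑ f : X → Z, (h f).toReal * traceNorm (ρ.hashed f - ρ.ideal Z) ≤
      ∑ z : Z, (2 * m⁻¹ * ∑ x, (ρ.part x * Q x).trace.re + 2 * l * m⁻¹ * k + l⁻¹) := by
    refine le_trans ?_ (Finset.sum_le_sum fun z _ => key z)
    rw [Finset.sum_comm]
    refine Finset.sum_le_sum fun f _ => ?_
    rw [← Finset.mul_sum]
    exact mul_le_mul_of_nonneg_left (ρ.traceNorm_le f hQ hQQ hτ hτ2 hl) ENNReal.toReal_nonneg
  rw [Finset.sum_const, Finset.card_univ, nsmul_eq_mul, ← hm_def] at h5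
  rw [CQState.insecurity]
  have h6 := mul_le_mul_of_nonneg_left h5 (show (0 : ℝ) ≤ 1 / 2 by norm_num)
  refine h6.trans (le_of_eq ?_)
  rw [hl_def]
  field_simp

end Achievability
section Main

variable {X E : Type*} [Fintype X] [DecidableEq X] [Fintype E] [DecidableEq E]

omit [DecidableEq X] in
theorem CQState.numEigenvalues_pos (ρ : CQState X E) : 0 < ρ.numEigenvalues := by
  have := ρ.nonempty_right
  exact (Set.ncard_pos ρ.marginal.finite_spectrum).2
    (spectrum.nonempty_of_isAlgClosed_of_finiteDimensional ℂ ρ.marginal)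

/-- If strongly 2-universal hashing to at most `2 * n` values is not `ε`-secret, then some test
between `ρ_XE` and `1 ⊗ ρ_E` has a small error. -/
theorem CQState.exists_test_of_lt_insecurity {Z : Type*} [Fintype Z] [DecidableEq Z] [Nonempty Z]
    (ρ : CQState X E) {h : PMF (X → Z)} (hh : IsStronglyTwoUniversal h) {ε δ : ℝ} (hε : ε < 1)
    (hδ : 0 < δ) (hδε : 3 * δ < ε) {n : ℝ} (hn : 1 ≤ n) (hZn : Fintype.card Z ≤ 2 * n)
    (hins : ε < ρ.insecurity h) :
    ∃ T : Matrix (X × E) (X × E) ℂ, 0 ≤ T ∧ T ≤ 1 ∧ 1 - (1 - ε + 3 * δ) ≤ (ρ.joint * T).trace.re ∧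
      (((1 : Matrix X X ℂ) ⊗ₖ ρ.marginal) * T).trace.re ≤
        n * ((ρ.numEigenvalues : ℝ) ^ 2 / δ ^ 4) := by
  have hν : (1 : ℝ) ≤ ρ.numEigenvalues := Nat.one_le_cast.2 ρ.numEigenvalues_pos
  set ν := (ρ.numEigenvalues : ℝ) with hν_def
  have hδ1 : δ ≤ 1 := by linarith
  have hδ4 : δ ^ 4 ≤ 1 := pow_le_one₀ hδ.le hδ1
  rcases subsingleton_or_nontrivial X with hX | hX
  · refine ⟨1, zero_le_one, le_rfl, ?_, ?_⟩
    · rw [mul_one, ρ.joint_eq, ← mul_one (directSum _), trace_directSum_mul]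
      simp only [block_one, mul_one, ρ.sum_trace_part, Complex.one_re]
      linarith
    · rw [mul_one, Matrix.trace_kronecker, ρ.trace_marginal, mul_one, Matrix.trace_one,
        Complex.natCast_re]
      have h1 : (Fintype.card X : ℝ) ≤ 1 := by
        exact_mod_cast Fintype.card_le_one_iff_subsingleton.2 hX
      have h2 : 1 ≤ ν ^ 2 / δ ^ 4 := by
        rw [one_le_div (by positivity)]
        nlinarith
      nlinarith
  · set γ := δ ^ 4 / (n * ν ^ 2) with hγ_def
    have hγ : 0 < γ := by positivity
    choose Q hQ hQQ hγQ hkQ using fun x => exists_commuting_test (ρ.part_nonneg x)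
      ρ.marginal_nonneg hγ
    have hQ0 : ∀ x, 0 ≤ Q x := fun x => by
      rw [← hQQ x]
      nth_rw 1 [← (hQ x).star_eq]
      exact star_mul_self_nonneg _
    have hQ1 : ∀ x, Q x ≤ 1 := fun x => by
      have hR : IsSelfAdjoint (1 - Q x) := (IsSelfAdjoint.one _).sub (hQ x)
      have : 1 - Q x = star (1 - Q x) * (1 - Q x) := by
        rw [hR.star_eq, mul_sub, sub_mul _ _ (Q x), mul_one, one_mul, hQQ, sub_self, sub_zero]
      rw [← sub_nonneg, this]
      exact star_mul_self_nonneg _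
    refine ⟨directSum Q, directSum_nonneg hQ0, (directSum_mono hQ1).trans_eq directSum_one, ?_, ?_⟩
    · have h1 := ρ.insecurity_le hh hQ hQQ (k := ν * γ) (by positivity) hkQ hδ
      rw [ρ.joint_eq, trace_directSum_mul, Complex.re_sum]
      simp only [block_directSum]
      have h2 : Fintype.card Z * (ν * γ) / δ ≤ 2 * δ := by
        calc Fintype.card Z * (ν * γ) / δ ≤ 2 * n * (ν * γ) / δ := by gcongr
          _ = 2 * δ * (δ ^ 2 / ν) := by rw [hγ_def]; field_simp
          _ ≤ 2 * δ * 1 := by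
            have : δ ^ 2 / ν ≤ 1 := by
              rw [div_le_one (by positivity)]
              exact (pow_le_one₀ hδ.le hδ1).trans hν
            gcongr
          _ = 2 * δ := mul_one _
      linarith
    · rw [one_kronecker_eq, trace_directSum_mul, Complex.re_sum]
      simp only [block_directSum]
      have h1 : γ * ∑ x, (ρ.marginal * Q x).trace.re ≤ 1 := by
        rw [Finset.mul_sum]
        calc ∑ x, γ * (ρ.marginal * Q x).trace.re ≤ ∑ x, (ρ.part x).trace.re := by
              refine Finset.sum_le_sum fun x _ => (hγQ x).trans ?_
              simpa using re_trace_mul_mono (ρ.part_nonneg x) (hQ1 x)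
          _ = 1 := by rw [← Complex.re_sum, ρ.sum_trace_part, Complex.one_re]
      have h2 : n * (ν ^ 2 / δ ^ 4) = 1 / γ := by rw [hγ_def]; field_simp
      rw [h2, le_div_iff₀ hγ]
      linarith

theorem CQState.insecurity_of_unique {Z : Type*} [Fintype Z] [DecidableEq Z] [Unique Z]
    (ρ : CQState X E) (h : PMF (X → Z)) : ρ.insecurity h = 0 := by
  have : ∀ f : X → Z, ρ.hashed f - ρ.ideal Z = 0 := fun f => by
    rw [ρ.hashed_sub_ideal]
    ext a b
    simp [directSum_apply, Subsingleton.elim (f _) a.1, Subsingleton.elim a.1 b.1]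
  simp [CQState.insecurity, this, traceNorm]

theorem CQState.condHypTestEntropy_le (ρ : CQState X E) {η t : ℝ} (ht : 0 < t)
    {T : Matrix (X × E) (X × E) ℂ} (hT₀ : 0 ≤ T) (hT₁ : T ≤ 1)
    (hT : 1 - η ≤ (ρ.joint * T).trace.re)
    (hTt : (((1 : Matrix X X ℂ) ⊗ₖ ρ.marginal) * T).trace.re ≤ t) :
    ρ.condHypTestEntropy η ≤ (Real.log t : ℝ) := by
  have h1 : -ENNReal.log (ENNReal.ofReal
      (((1 : Matrix X X ℂ) ⊗ₖ ρ.marginal) * T).trace.re) ≤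
      hypTestDivergence η ρ.joint ((1 : Matrix X X ℂ) ⊗ₖ ρ.marginal) :=
    le_sSup ⟨T, Matrix.nonneg_iff_posSemidef.1 hT₀, Matrix.le_iff.1 hT₁, hT, rfl⟩
  rw [CQState.condHypTestEntropy, ← ENNReal.log_ofReal_of_pos ht]
  exact (EReal.neg_le.1 h1).trans (ENNReal.log_le_log (ENNReal.ofReal_le_ofReal hTt))

theorem CQState.le_log_maxExtractableWith (ρ : CQState X E) {ε δ : ℝ} (hε : ε < 1)
    (hδ : 0 < δ) (hδε : 3 * δ < ε) {h : ∀ m : ℕ+, PMF (X → Fin m)}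
    (hh : ∀ m, IsStronglyTwoUniversal (h m)) :
    ρ.condHypTestEntropy (1 - ε + 3 * δ)
        - ((Real.log ((ρ.numEigenvalues : ℝ) ^ 2 / δ ^ 4) : ℝ) : EReal)
      ≤ ENNReal.log (ρ.maxExtractableWith h ε : ENNReal) := by
  have hmem : ∀ m : ℕ+, ρ.insecurity (h m) ≤ ε → ((m : ℕ) : ℕ∞) ≤ ρ.maxExtractableWith h ε :=
    fun m hm => le_sSup ⟨m, rfl, m, le_rfl, hm⟩
  have h1 : ((1 : ℕ) : ℕ∞) ≤ ρ.maxExtractableWith h ε :=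
    hmem 1 ((CQState.insecurity_of_unique (Z := Fin 1) ρ (h 1)).trans_le (by linarith))
  rcases eq_or_ne (ρ.maxExtractableWith h ε) ⊤ with htop | htop
  · rw [htop]; simp
  obtain ⟨n, hn⟩ := ENat.ne_top_iff_exists.1 htop
  rw [← hn] at h1 hmem ⊢
  have hn1 : 1 ≤ n := by exact_mod_cast h1
  have hlt : ε < ρ.insecurity (h n.succPNat) := by
    by_contra hle
    have := hmem _ (not_lt.1 hle)
    rw [Nat.cast_le] at this
    simp at this
  have hn1' : (1 : ℝ) ≤ n := by exact_mod_cast hn1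
  obtain ⟨T, hT₀, hT₁, hT, hTn⟩ := ρ.exists_test_of_lt_insecurity (hh n.succPNat) hε hδ hδε hn1'
    (by rw [Fintype.card_fin, Nat.succPNat_coe, Nat.cast_succ]; linarith) hlt
  have hν : (0 : ℝ) < ρ.numEigenvalues := Nat.cast_pos.2 ρ.numEigenvalues_pos
  have hL : 0 < (ρ.numEigenvalues : ℝ) ^ 2 / δ ^ 4 := by positivity
  have h2 := ρ.condHypTestEntropy_le (by positivity) hT₀ hT₁ hT hTn
  rw [Real.log_mul (by positivity) hL.ne', EReal.coe_add] at h2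
  have h3 : ENNReal.log ((n : ℕ∞) : ENNReal) = (Real.log n : ℝ) := by
    rw [← ENNReal.log_ofReal_of_pos (by positivity), ENNReal.ofReal_natCast]; simp
  rw [h3]
  exact EReal.sub_le_of_le_add h2

theorem CQState.maxExtractableWith_le (ρ : CQState X E) {ε : ℝ} {h : ∀ m : ℕ+, PMF (X → Fin m)}
    (hh : ∀ m, IsStronglyTwoUniversal (h m)) :
    ρ.maxExtractableWith h ε ≤ ρ.maxExtractable ε := by
  refine sSup_le_sSup ?_
  rintro r ⟨l, rfl, m, hlm, hm⟩
  exact ⟨l, rfl, m, h m, hh m, hlm, hm⟩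

theorem log_natCast_enat_mono {a b : ℕ∞} (h : a ≤ b) :
    ENNReal.log (a : ENNReal) ≤ ENNReal.log (b : ENNReal) :=
  ENNReal.log_le_log (ENat.toENNReal_le.2 h)

theorem CQState.log_maxExtractable_le (ρ : CQState X E) {ε δ c : ℝ} (hε : ε < 1)
    (hc : 0 < c) (hcδ : c < δ) (hδε : 3 * δ < ε) :
    ENNReal.log (ρ.maxExtractable ε : ENNReal)
      ≤ ρ.condHypTestEntropy (1 - ε - 2 * δ)
        + ((Real.log ((1 + c) / (c * δ)) : ℝ) : EReal)
        + ((Real.log ((ε + c) / (δ - c)) : ℝ) : EReal) := by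
  have hδ : 0 < δ := hc.trans hcδ
  have hdc : 0 < δ - c := by linarith
  have hε0 : 0 < ε := by linarith
  have ha : 0 < (1 + c) / (c * δ) := by positivity
  have hb : 0 < (ε + c) / (δ - c) := by positivity
  rw [add_assoc, ← EReal.coe_add, ← Real.log_mul ha.ne' hb.ne']
  set C := (1 + c) / (c * δ) * ((ε + c) / (δ - c)) with hC
  have hC0 : 0 < C := mul_pos ha hb
  rw [← EReal.sub_le_iff_le_add (Or.inl (EReal.coe_ne_bot _)) (Or.inl (EReal.coe_ne_top _)),
    CQState.condHypTestEntropy, EReal.le_neg]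
  refine sSup_le ?_
  rintro _ ⟨T, hT₀, hT₁, hT, rfl⟩
  rw [EReal.neg_le_neg_iff, EReal.sub_le_iff_le_add (Or.inl (EReal.coe_ne_bot _))
    (Or.inl (EReal.coe_ne_top _)), ← ENNReal.log_ofReal_of_pos hC0, ← ENNReal.log_mul_add,
    ← ENNReal.ofReal_mul' hC0.le]
  set t := (((1 : Matrix X X ℂ) ⊗ₖ ρ.marginal) * T).trace.re
  refine ENNReal.log_le_log ?_
  have h1 : ρ.maxExtractable ε ≤ ((⌊t * C⌋₊ : ℕ) : ℕ∞) := by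
    refine sSup_le ?_
    rintro _ ⟨l, rfl, m, h, -, hlm, hm⟩
    have : Nonempty (Fin m) := ⟨⟨0, m.pos⟩⟩
    have h2 := ρ.card_le_of_insecurity_le h hε hc hcδ hδε hm
      (Matrix.nonneg_iff_posSemidef.2 hT₀) (Matrix.le_iff.2 hT₁) (by linarith)
    rw [Fintype.card_fin, mul_assoc] at h2
    exact Nat.cast_le.2 (hlm.trans (Nat.le_floor h2))
  have h0 : 0 ≤ t * C := mul_nonneg (re_trace_mul_nonneg (by
    rw [one_kronecker_eq]
    exact directSum_nonneg fun _ => ρ.marginal_nonneg)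
    (Matrix.nonneg_iff_posSemidef.2 hT₀)) hC0.le
  refine (ENat.toENNReal_le.2 h1).trans ?_
  rw [ENat.toENNReal_coe, ← ENNReal.ofReal_natCast]
  exact ENNReal.ofReal_le_ofReal (Nat.floor_le h0)

end Main
end PrivacyAmplification

theorem theorem1 {X E : Type*} [Fintype X] [DecidableEq X] [Fintype E] [DecidableEq E]
    (ρ : PrivacyAmplification.CQState X E) (ε δ c : ℝ) (hε0 : 0 < ε) (hε1 : ε < 1)
    (hc : 0 < c) (hcδ : c < δ) (hδ : δ < min (ε / 3) ((1 - ε) / 2)) :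
    (ρ.condHypTestEntropy (1 - ε + 3 * δ)
          - ((Real.log ((ρ.numEigenvalues : ℝ) ^ 2 / δ ^ 4) : ℝ) : EReal)
        ≤ ENNReal.log (ρ.maxExtractable ε : ENNReal) ∧
      ENNReal.log (ρ.maxExtractable ε : ENNReal)
        ≤ ρ.condHypTestEntropy (1 - ε - 2 * δ)
          + ((Real.log ((1 + c) / (c * δ)) : ℝ) : EReal)
          + ((Real.log ((ε + c) / (δ - c)) : ℝ) : EReal)) ∧
    ∀ h : ∀ m : ℕ+, PMF (X → Fin m),
      (∀ m, PrivacyAmplification.IsStronglyTwoUniversal (h m)) →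
      ρ.condHypTestEntropy (1 - ε + 3 * δ)
          - ((Real.log ((ρ.numEigenvalues : ℝ) ^ 2 / δ ^ 4) : ℝ) : EReal)
        ≤ ENNReal.log (ρ.maxExtractableWith h ε : ENNReal) ∧
      ENNReal.log (ρ.maxExtractableWith h ε : ENNReal)
        ≤ ρ.condHypTestEntropy (1 - ε - 2 * δ)
          + ((Real.log ((1 + c) / (c * δ)) : ℝ) : EReal)
          + ((Real.log ((ε + c) / (δ - c)) : ℝ) : EReal) := by
  have hδε : 3 * δ < ε := by
    have := hδ.trans_le (min_le_left _ _)
    linarith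
  have hδ0 : 0 < δ := hc.trans hcδ
  have upper := ρ.log_maxExtractable_le hε1 hc hcδ hδε
  refine ⟨⟨?_, upper⟩, fun h hh => ⟨ρ.le_log_maxExtractableWith hε1 hδ0 hδε hh, ?_⟩⟩
  · have hu : ∀ m : ℕ+, PrivacyAmplification.IsStronglyTwoUniversal
        (@PMF.uniformOfFintype (X → Fin m) _ ⟨fun _ => ⟨0, m.pos⟩⟩) := fun m => by
      have : Nonempty (Fin m) := ⟨⟨0, m.pos⟩⟩
      exact PrivacyAmplification.isStronglyTwoUniversal_uniform
    exact (ρ.le_log_maxExtractableWith hε1 hδ0 hδε hu).trans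
      (PrivacyAmplification.log_natCast_enat_mono (ρ.maxExtractableWith_le hu))
  · exact (PrivacyAmplification.log_natCast_enat_mono (ρ.maxExtractableWith_le hh)).trans upper
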